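/- For a positive integer $n$, let $\mathrm{FA}(n)$ be the sub-lattice-ordered group of $\mathbb{Z}^{\mathbb{Z}^n}$ (all maps $\mathbb{Z}^n\to\mathbb{Z}$, with pointwise addition and ordering) generated by the $n$ canonical projections; it is the free abelian lattice-ordered group on $n$ generators. An $\ell$-ideal of an abelian lattice-ordered group is a convex subgroup closed under $\wedge$ and $\vee$; it is finitely generated if it is the least $\ell$-ideal containing some finite set. An abelian lattice-ordered group is finitely presented if it is isomorphic (as a lattice-ordered group) to $\mathrm{FA}(n)/I$ for some positive integer $n$ and some finitely generated $\ell$-ideal $I$ of $\mathrm{FA}(n)$. A partially ordered abelian group $B$ is finitely related if it is a finitely generated group and, for every positive integer $n$ and all $u_1,\dots,u_n$ generating $B$ as a group, the set $\{(x_1,\dots,x_n)\in\mathbb{Z}^n \mid x_1u_1+\cdots+x_nu_n\ge 0 \text{ and } x_j\ge 0 \text{ for all } j\}$ is a finitely generated submonoid of $\mathbb{Z}^n$. A partially ordered abelian group $A$ is po-coherent (as a $\mathbb{Z}$-module) if every finitely generated subgroup of $A$, with the induced ordering, is finitely related. Theorem. Every finitely presented abelian lattice-ordered group, viewed as a partially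 ordered abelian group, is po-coherent. -/

import Mathlib

/-! ### Finitely related and po-coherent partially ordered modules -/

section PoCoherence

variable (R : Type*) [Ring R] [PartialOrder R] [IsOrderedRing R]
variable {A : Type*} [AddCommGroup A] [PartialOrder A] [IsOrderedAddMonoid A]
  [Module R A] [PosSMulMono R A]

/-- The solution set in `Rⁿ` of the mixed system `U X ≥ 0`, `X ≥ 0`, where `U` is a row of `n`
elements of the partially ordered module `A`. It is an `R⁺`-subsemimodule of `Rⁿ`
(Mathlib: `PointedCone`, the submodules over the semiring of nonnegative scalars). -/
def mixedSolutions {n : ℕ} (U : Fin n → A) : PointedCone R (Fin n → R) where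
  carrier := {X | 0 ≤ ∑ j, X j • U j ∧ 0 ≤ X}
  zero_mem' := by simp
  add_mem' := by
    rintro X Y ⟨hX, hX'⟩ ⟨hY, hY'⟩
    refine ⟨?_, add_nonneg hX' hY'⟩
    simpa [add_smul, Finset.sum_add_distrib] using add_nonneg hX hY
  smul_mem' := by
    rintro ⟨c, hc⟩ X ⟨hX, hX'⟩
    refine ⟨?_, fun j => mul_nonneg hc (hX' j)⟩
    have h := smul_nonneg hc hX
    rw [Finset.smul_sum] at h
    simpa [mul_smul] using h

/-- `A` is finitely related at the row `U`: the solution set of `U X ≥ 0`, `X ≥ 0` is a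
finitely generated `R⁺`-semimodule. -/
def FinitelyRelatedAt {n : ℕ} (U : Fin n → A) : Prop :=
  (mixedSolutions R U).FG

variable (A)

/-- `A` is finitely related: it is a finitely generated module, and it is finitely related at
every spanning row of elements of `A`. -/
def FinitelyRelated : Prop :=
  Module.Finite R A ∧
    ∀ (n : ℕ) (U : Fin n → A), 0 < n → Submodule.span R (Set.range U) = ⊤ →
      FinitelyRelatedAt R U

/-- A submodule with the induced ordering is again a partially ordered module. -/
instance Submodule.instPosSMulMonoInduced (B : Submodule R A) : PosSMulMono R B :=
  ⟨fun _ hc _ _ h => smul_le_smul_of_nonneg_left (β := A) h hc⟩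

/-- `A` is po-coherent: every finitely generated submodule of `A`, with the induced ordering,
is finitely related. -/
def PoCoherent : Prop :=
  ∀ B : Submodule R A, B.FG → FinitelyRelated R B

end PoCoherence

/-! ### Finitely presented abelian lattice-ordered groups -/

/-- The additive subgroup `H` is closed under the lattice operations. -/
def AddSubgroup.IsLSubgroup {G : Type*} [AddCommGroup G] [Lattice G] (H : AddSubgroup G) : Prop :=
  ∀ f ∈ H, ∀ g ∈ H, f ⊔ g ∈ H ∧ f ⊓ g ∈ H

/-- An `ℓ`-ideal of an abelian lattice-ordered group: a convex subgroup closed under the lattice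
operations. -/
def AddSubgroup.IsLIdeal {G : Type*} [AddCommGroup G] [Lattice G] (I : AddSubgroup G) : Prop :=
  (I : Set G).OrdConnected ∧ I.IsLSubgroup

/-- The `ℓ`-ideal `I` is finitely generated: it is the least `ℓ`-ideal that contains some finite
set. -/
def AddSubgroup.IsFGLIdeal {G : Type*} [AddCommGroup G] [Lattice G] (I : AddSubgroup G) : Prop :=
  ∃ S : Finset G, IsLeast {J : AddSubgroup G | J.IsLIdeal ∧ (S : Set G) ⊆ J} I

/-- The free abelian lattice-ordered group on `n` generators: the sub-lattice-ordered group of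
the group of all maps `ℤⁿ → ℤ`, ordered pointwise, that is generated by the `n` canonical
projections. -/
def FA (n : ℕ) : AddSubgroup ((Fin n → ℤ) → ℤ) :=
  sInf {H | H.IsLSubgroup ∧ ∀ i : Fin n, (fun x : Fin n → ℤ => x i) ∈ H}

theorem FA_isLSubgroup (n : ℕ) : (FA n).IsLSubgroup := by
  intro f hf g hg
  rw [FA, AddSubgroup.mem_sInf] at hf hg
  simp only [FA, AddSubgroup.mem_sInf]
  exact ⟨fun H hH => (hH.1 f (hf H hH) g (hg H hH)).1,
    fun H hH => (hH.1 f (hf H hH) g (hg H hH)).2⟩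

/-- The lattice operations of `FA n` are the pointwise ones. -/
instance FA.instLattice (n : ℕ) : Lattice (FA n) :=
  Subtype.lattice (fun {f g} hf hg => (FA_isLSubgroup n f hf g hg).1)
    (fun {f g} hf hg => (FA_isLSubgroup n f hf g hg).2)

/-- An abelian lattice-ordered group `G` is finitely presented: it is isomorphic, as a
lattice-ordered group, to a quotient `FA n ⧸ I` where `n` is a positive integer and `I` is a
finitely generated `ℓ`-ideal of `FA n`. The lattice operations of the quotient are those induced
by representatives. -/
def IsFinitelyPresentedLGroup (G : Type*) [AddCommGroup G] [Lattice G] : Prop :=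
  ∃ (n : ℕ) (I : AddSubgroup (FA n)), 0 < n ∧ I.IsFGLIdeal ∧
    ∃ e : (FA n ⧸ I) ≃+ G,
      (∀ f g : FA n, e ((f ⊔ g : FA n) : FA n ⧸ I) = e (f : FA n ⧸ I) ⊔ e (g : FA n ⧸ I)) ∧
      (∀ f g : FA n, e ((f ⊓ g : FA n) : FA n ⧸ I) = e (f : FA n ⧸ I) ⊓ e (g : FA n ⧸ I))

/-! Elements of `FA n` are piecewise additive: finitely many finitely generated submonoids cover
`ℤⁿ`, and the function is additive on each (`FA.piecewiseAdditive`). A finitely generated `ℓ`-ideal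
consists of the `f` with `|f| ≤ k g` for some `k`, where `g ≥ 0` is fixed, so the class of `a` is
nonnegative iff `-a ≤ k g` for some `k`. On a cover common to `a` and `g`, this need only be checked
at generators `t` of the pieces. Where `g t > 0` a large `k` suffices; where `g t = 0` the condition
is `a t ≥ 0` (`exists_finite_test`). For `a = ∑ Xⱼ fⱼ` these are finitely many linear inequalities
in `X`, independent of `k`, and such a system has a finitely generated monoid of solutions
(`FG.sep_nonneg`). -/

namespace AddSubmonoid

/-- The intersection of two finitely generated submonoids of a cancellative commutative monoid is
finitely generated. -/
theorem FG.inf_of_isCancelAdd {M : Type*} [AddCommMonoid M] [IsCancelAdd M]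
    {P Q : AddSubmonoid M} (hP : P.FG) (hQ : Q.FG) : (P ⊓ Q).FG := by
  obtain ⟨p, f, rfl⟩ := fg_iff_exists_fin_addMonoidHom.1 hP
  obtain ⟨q, g, rfl⟩ := fg_iff_exists_fin_addMonoidHom.1 hQ
  have h := fg_eqLocusM (f.comp (AddMonoidHom.fst (Fin p → ℕ) (Fin q → ℕ)))
    (g.comp (AddMonoidHom.snd (Fin p → ℕ) (Fin q → ℕ)))
  convert h.map (f.comp (AddMonoidHom.fst (Fin p → ℕ) (Fin q → ℕ)))
  ext x
  constructor
  · rintro ⟨⟨a, rfl⟩, ⟨b, hb⟩⟩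
    exact ⟨(a, b), hb.symm, rfl⟩
  · rintro ⟨⟨a, b⟩, hab, rfl⟩
    exact ⟨⟨a, rfl⟩, ⟨b, Eq.symm hab⟩⟩

/-- The function `f` is additive on the submonoid `P`. -/
def AdditiveOn {M : Type*} [AddCommMonoid M] (P : AddSubmonoid M) (f : M → ℤ) : Prop :=
  ∀ x ∈ P, ∀ y ∈ P, f (x + y) = f x + f y

section AdditiveOn

variable {M : Type*} [AddCommMonoid M] {P Q : AddSubmonoid M} {f g : M → ℤ}

theorem AdditiveOn.map_zero (hf : P.AdditiveOn f) : f 0 = 0 := by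
  simpa using hf 0 P.zero_mem 0 P.zero_mem

theorem AdditiveOn.mono (hf : P.AdditiveOn f) (h : Q ≤ P) : Q.AdditiveOn f :=
  fun x hx y hy => hf x (h hx) y (h hy)

theorem AdditiveOn.congr (hf : P.AdditiveOn f) (h : ∀ x ∈ P, g x = f x) : P.AdditiveOn g := by
  intro x hx y hy
  rw [h x hx, h y hy, h _ (P.add_mem hx hy), hf x hx y hy]

theorem AdditiveOn.add (hf : P.AdditiveOn f) (hg : P.AdditiveOn g) : P.AdditiveOn (f + g) := by
  intro x hx y hy
  simp only [Pi.add_apply, hf x hx y hy, hg x hx y hy]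
  ring

theorem AdditiveOn.neg (hf : P.AdditiveOn f) : P.AdditiveOn (-f) := by
  intro x hx y hy
  simp only [Pi.neg_apply, hf x hx y hy]
  ring

/-- The part of `P` on which `f` is nonnegative. -/
def nonnegPart (P : AddSubmonoid M) (f : M → ℤ) (hf : P.AdditiveOn f) : AddSubmonoid M where
  carrier := {x | x ∈ P ∧ 0 ≤ f x}
  zero_mem' := ⟨P.zero_mem, hf.map_zero.ge⟩
  add_mem' := by
    rintro x y ⟨hx, hx'⟩ ⟨hy, hy'⟩
    exact ⟨P.add_mem hx hy, by rw [hf x hx y hy]; exact add_nonneg hx' hy'⟩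

theorem mem_nonnegPart {hf : P.AdditiveOn f} {x : M} : x ∈ P.nonnegPart f hf ↔ x ∈ P ∧ 0 ≤ f x :=
  Iff.rfl

theorem nonnegPart_le (hf : P.AdditiveOn f) : P.nonnegPart f hf ≤ P := fun _ hx => hx.1

/-- A slack variable `b : ℕ` turns `0 ≤ f` into the equation `f (π a) = b`, whose solutions form an
equalizer of maps between finitely generated monoids. -/
theorem FG.nonnegPart (hP : P.FG) (hf : P.AdditiveOn f) : (P.nonnegPart f hf).FG := by
  obtain ⟨p, π, rfl⟩ := fg_iff_exists_fin_addMonoidHom.1 hP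
  let φ : (Fin p → ℕ) →+ ℤ :=
    { toFun := fun a => f (π a)
      map_zero' := by rw [map_zero, hf.map_zero]
      map_add' := fun a b => by rw [map_add]; exact hf _ ⟨a, rfl⟩ _ ⟨b, rfl⟩ }
  have h := fg_eqLocusM (φ.comp (AddMonoidHom.fst (Fin p → ℕ) ℕ))
    ((Nat.castAddMonoidHom ℤ).comp (AddMonoidHom.snd (Fin p → ℕ) ℕ))
  convert h.map (π.comp (AddMonoidHom.fst (Fin p → ℕ) ℕ))
  ext x
  constructor
  · rintro ⟨⟨a, rfl⟩, hx⟩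
    exact ⟨(a, (f (π a)).toNat), (Int.toNat_of_nonneg hx).symm, rfl⟩
  · rintro ⟨⟨a, b⟩, hab, rfl⟩
    have hab' : f (π a) = (b : ℤ) := hab
    exact ⟨⟨a, rfl⟩, by simp [hab']⟩

/-- Finitely many linear inequalities cut a finitely generated submonoid out of a finitely
generated one. -/
theorem FG.sep_nonneg (hP : P.FG) {H : Set (M →+ ℤ)} (hH : H.Finite) :
    ∃ Q : AddSubmonoid M, Q.FG ∧ ∀ x, x ∈ Q ↔ x ∈ P ∧ ∀ h ∈ H, 0 ≤ h x := by
  induction H, hH using Set.Finite.induction_on with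
  | empty => exact ⟨P, hP, by simp⟩
  | @insert h H _ _ ih =>
    obtain ⟨Q, hQ, hmem⟩ := ih
    have hadd : Q.AdditiveOn h := fun x _ y _ => map_add h x y
    refine ⟨Q.nonnegPart h hadd, hQ.nonnegPart hadd, fun x => ?_⟩
    rw [mem_nonnegPart, hmem, Set.forall_mem_insert]
    tauto

end AdditiveOn

theorem fg_nonneg_pi (m : ℕ) : (AddSubmonoid.nonneg (Fin m → ℤ)).FG := by
  refine fg_iff_exists_fin_addMonoidHom.2
    ⟨m, (Nat.castAddMonoidHom ℤ).compLeft (Fin m), ?_⟩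
  ext x
  constructor
  · rintro ⟨a, rfl⟩
    exact fun j => Int.natCast_nonneg (a j)
  · intro hx
    exact ⟨fun j => (x j).toNat, funext fun j => Int.toNat_of_nonneg (hx j)⟩

end AddSubmonoid

theorem PointedCone.fg_of_toAddSubmonoid_fg {R M : Type*} [Ring R] [PartialOrder R]
    [IsOrderedRing R] [AddCommGroup M] [Module R M] {P : PointedCone R M}
    (h : P.toAddSubmonoid.FG) : P.FG := by
  obtain ⟨S, hS⟩ := h
  refine ⟨S, le_antisymm (Submodule.span_le.2 fun x hx => ?_) fun x hx => ?_⟩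
  · have : x ∈ P.toAddSubmonoid := hS ▸ AddSubmonoid.subset_closure hx
    exact this
  · have hx' : x ∈ AddSubmonoid.closure (S : Set M) := hS ▸ hx
    have hle : AddSubmonoid.closure (S : Set M) ≤
        (Submodule.span {c : R // 0 ≤ c} (S : Set M)).toAddSubmonoid :=
      AddSubmonoid.closure_le.2 Submodule.subset_span
    exact hle hx'

/-! ### Piecewise additive functions -/

/-- The functions in `F` are simultaneously piecewise additive: finitely many finitely generated
submonoids cover `M`, and every function in `F` is additive on each of them. -/
def PiecewiseAdditive {M : Type*} [AddCommMonoid M] (F : Set (M → ℤ)) : Prop :=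
  ∃ 𝒞 : Set (AddSubmonoid M), 𝒞.Finite ∧ (∀ x, ∃ C ∈ 𝒞, x ∈ C) ∧
    ∀ C ∈ 𝒞, C.FG ∧ ∀ f ∈ F, C.AdditiveOn f

namespace PiecewiseAdditive

theorem mono {M : Type*} [AddCommMonoid M] {F F' : Set (M → ℤ)} (hF : PiecewiseAdditive F)
    (h : ∀ C : AddSubmonoid M, (∀ f ∈ F, C.AdditiveOn f) → ∀ f ∈ F', C.AdditiveOn f) :
    PiecewiseAdditive F' := by
  obtain ⟨𝒞, hfin, hcov, h𝒞⟩ := hF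
  exact ⟨𝒞, hfin, hcov, fun C hC => ⟨(h𝒞 C hC).1, h C (h𝒞 C hC).2⟩⟩

theorem union {M : Type*} [AddCommMonoid M] [IsCancelAdd M] {F F' : Set (M → ℤ)}
    (hF : PiecewiseAdditive F) (hF' : PiecewiseAdditive F') : PiecewiseAdditive (F ∪ F') := by
  obtain ⟨𝒞, hfin, hcov, h𝒞⟩ := hF
  obtain ⟨𝒟, hfin', hcov', h𝒟⟩ := hF'
  refine ⟨Set.image2 (· ⊓ ·) 𝒞 𝒟, hfin.image2 _ hfin', fun x => ?_, ?_⟩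
  · obtain ⟨C, hC, hx⟩ := hcov x
    obtain ⟨D, hD, hx'⟩ := hcov' x
    exact ⟨C ⊓ D, Set.mem_image2_of_mem hC hD, hx, hx'⟩
  · rintro _ ⟨C, hC, D, hD, rfl⟩
    refine ⟨(h𝒞 C hC).1.inf_of_isCancelAdd (h𝒟 D hD).1, ?_⟩
    rintro f (hf | hf)
    · exact ((h𝒞 C hC).2 f hf).mono inf_le_left
    · exact ((h𝒟 D hD).2 f hf).mono inf_le_right

theorem of_finite {M : Type*} [AddCommMonoid M] [IsCancelAdd M] [AddMonoid.FG M]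
    {F : Set (M → ℤ)} (hfin : F.Finite) (hF : ∀ f ∈ F, PiecewiseAdditive {f}) :
    PiecewiseAdditive F := by
  induction F, hfin using Set.Finite.induction_on with
  | empty =>
    exact ⟨{⊤}, Set.finite_singleton _, by simp, by simpa using AddMonoid.FG.fg_top⟩
  | @insert f F _ _ ih =>
    rw [Set.forall_mem_insert] at hF
    exact hF.1.union (ih hF.2)

/-- A cover for `f` and `g` can be refined to one that is also a cover for `f ⊔ g`. -/
theorem sup {M : Type*} [AddCommMonoid M] [IsCancelAdd M] {f g : M → ℤ}
    (hf : PiecewiseAdditive {f}) (hg : PiecewiseAdditive {g}) : PiecewiseAdditive {f ⊔ g} := by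
  obtain ⟨𝒞, hfin, hcov, h𝒞⟩ := hf.union hg
  have hfC : ∀ C : 𝒞, C.1.AdditiveOn f := fun C => (h𝒞 C C.2).2 f (by simp)
  have hgC : ∀ C : 𝒞, C.1.AdditiveOn g := fun C => (h𝒞 C C.2).2 g (by simp)
  have := hfin.to_subtype
  -- Cut each common piece by the sign of `f - g`; on either part the supremum is just `f` or `g`.
  refine ⟨Set.range (fun C : 𝒞 => C.1.nonnegPart (f + -g) ((hfC C).add (hgC C).neg)) ∪
    Set.range (fun C : 𝒞 => C.1.nonnegPart (g + -f) ((hgC C).add (hfC C).neg)),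
    (Set.finite_range _).union (Set.finite_range _), fun x => ?_, ?_⟩
  · obtain ⟨C, hC, hx⟩ := hcov x
    rcases le_total (g x) (f x) with h | h
    · exact ⟨_, Or.inl ⟨⟨C, hC⟩, rfl⟩, hx, by simpa using h⟩
    · exact ⟨_, Or.inr ⟨⟨C, hC⟩, rfl⟩, hx, by simpa using h⟩
  · rintro _ (⟨C, rfl⟩ | ⟨C, rfl⟩)
    · refine ⟨(h𝒞 C C.2).1.nonnegPart _, ?_⟩
      rintro _ rfl
      refine ((hfC C).mono (AddSubmonoid.nonnegPart_le _)).congr fun x hx => ?_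
      have := hx.2
      simp only [Pi.add_apply, Pi.neg_apply] at this
      exact sup_of_le_left (by omega)
    · refine ⟨(h𝒞 C C.2).1.nonnegPart _, ?_⟩
      rintro _ rfl
      refine ((hgC C).mono (AddSubmonoid.nonnegPart_le _)).congr fun x hx => ?_
      have := hx.2
      simp only [Pi.add_apply, Pi.neg_apply] at this
      exact sup_of_le_right (by omega)

theorem neg {M : Type*} [AddCommMonoid M] {f : M → ℤ} (hf : PiecewiseAdditive {f}) :
    PiecewiseAdditive {-f} :=
  hf.mono (by simpa using fun C h => AddSubmonoid.AdditiveOn.neg h)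

theorem of_addMonoidHom {M : Type*} [AddCommMonoid M] [AddMonoid.FG M] (φ : M →+ ℤ) :
    PiecewiseAdditive {(φ : M → ℤ)} :=
  ⟨{⊤}, Set.finite_singleton _, by simp, by
    simpa using ⟨AddMonoid.FG.fg_top, fun x _ y _ => map_add φ x y⟩⟩

/-- The piecewise additive functions form a group. -/
def addSubgroup (M : Type*) [AddCommMonoid M] [IsCancelAdd M] [AddMonoid.FG M] :
    AddSubgroup (M → ℤ) where
  carrier := {f | PiecewiseAdditive {f}}
  zero_mem' := of_addMonoidHom 0
  add_mem' := fun {f g} hf hg => (PiecewiseAdditive.union hf hg).mono fun C h => by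
    simpa using (h f (by simp)).add (h g (by simp))
  neg_mem' := fun hf => PiecewiseAdditive.neg hf

theorem isLSubgroup_addSubgroup (M : Type*) [AddCommMonoid M] [IsCancelAdd M] [AddMonoid.FG M] :
    (addSubgroup M).IsLSubgroup := by
  intro f hf g hg
  refine ⟨PiecewiseAdditive.sup hf hg, ?_⟩
  have h : f ⊓ g = -(-f ⊔ -g) := by rw [neg_sup, neg_neg, neg_neg]
  rw [h]
  exact (PiecewiseAdditive.sup (PiecewiseAdditive.neg hf) (PiecewiseAdditive.neg hg)).neg

/-- Finitely many points of `M` decide whether a combination `h` of finitely many piecewise additive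
functions is nonnegative up to a multiple of a nonnegative piecewise additive function `g`. -/
theorem exists_finite_test {M : Type*} [AddCommMonoid M] {F : Set (M → ℤ)} {g : M → ℤ}
    (hF : PiecewiseAdditive (insert g F)) (hg : 0 ≤ g) :
    ∃ T : Set M, T.Finite ∧
      ∀ h : M → ℤ, (∀ C : AddSubmonoid M, (∀ f ∈ F, C.AdditiveOn f) → C.AdditiveOn h) →
        ((∃ k : ℕ, ∀ x, -h x ≤ k * g x) ↔ ∀ t ∈ T, 0 ≤ h t) := by
  obtain ⟨𝒞, hfin, hcov, h𝒞⟩ := hF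
  have hgen : ∀ C : 𝒞, ∃ S : Set M, AddSubmonoid.closure S = C.1 ∧ S.Finite :=
    fun C => (AddSubmonoid.fg_iff _).1 (h𝒞 C C.2).1
  choose S hS hSfin using hgen
  have := hfin.to_subtype
  have hUfin : (⋃ C, S C).Finite := Set.finite_iUnion hSfin
  -- The test points are the generators at which no multiple of `g` can compensate a negative value
  -- of `h`.
  refine ⟨{t | t ∈ ⋃ C, S C ∧ g t = 0}, hUfin.subset fun t ht => ht.1,
    fun h hh => ⟨?_, fun hT => ?_⟩⟩
  · rintro ⟨k, hk⟩ t ⟨-, ht⟩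
    have := hk t
    rw [ht, mul_zero] at this
    omega
  · have hbound : ∃ k : ℕ, ∀ t ∈ ⋃ C, S C, (h t).natAbs ≤ k := by
      obtain ⟨k, hk⟩ := (hUfin.image fun t => (h t).natAbs).bddAbove
      exact ⟨k, fun t ht => hk ⟨t, ht, rfl⟩⟩
    obtain ⟨k, hk⟩ := hbound
    refine ⟨k, fun x => ?_⟩
    obtain ⟨C, hC, hx⟩ := hcov x
    have hgC : C.AdditiveOn g := (h𝒞 C hC).2 g (by simp)
    have hhC : C.AdditiveOn h := hh C fun f hf => (h𝒞 C hC).2 f (by simp [hf])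
    have hcl : AddSubmonoid.closure (S ⟨C, hC⟩) = C := hS ⟨C, hC⟩
    rw [← hcl] at hx hgC hhC
    induction hx using AddSubmonoid.closure_induction with
    | mem t ht =>
      have htU : t ∈ ⋃ C, S C := Set.mem_iUnion.2 ⟨_, ht⟩
      have hgt : 0 ≤ g t := hg t
      rcases hgt.eq_or_lt with h0 | h0
      · have := hT t ⟨htU, h0.symm⟩
        rw [← h0]
        omega
      · have := hk t htU
        have hk0 : (k : ℤ) * 1 ≤ k * g t := by gcongr; omega
        omega
    | zero => simp [hgC.map_zero, hhC.map_zero]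
    | add x y hx hy ihx ihy =>
      rw [hgC x hx y hy, hhC x hx y hy, mul_add]
      linarith

end PiecewiseAdditive

/-! ### Free abelian `ℓ`-groups and their finitely generated `ℓ`-ideals -/

/-- The piecewise additive functions form an `ℓ`-subgroup containing the projections, and `FA n` is
the least such. -/
theorem FA.piecewiseAdditive {n : ℕ} (f : FA n) : PiecewiseAdditive {(f : (Fin n → ℤ) → ℤ)} := by
  have hfg : AddMonoid.FG (Fin n → ℤ) := AddGroup.fg_iff_addMonoid_fg.1 inferInstance
  exact AddSubgroup.mem_sInf.1 f.2 (PiecewiseAdditive.addSubgroup (Fin n → ℤ))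
    ⟨PiecewiseAdditive.isLSubgroup_addSubgroup _,
      fun i => PiecewiseAdditive.of_addMonoidHom (Pi.evalAddMonoidHom (fun _ => ℤ) i)⟩

theorem FA.le_iff {n : ℕ} {f g : FA n} : f ≤ g ↔ ∀ x, f.1 x ≤ g.1 x := Iff.rfl

/-- The elements of `FA n` that are bounded by a multiple of `g`. -/
def FA.principalIdeal {n : ℕ} (g : FA n) : AddSubgroup (FA n) where
  carrier := {f | ∃ k : ℕ, ∀ x, |f.1 x| ≤ k * g.1 x}
  zero_mem' := ⟨0, fun x => by simp⟩
  add_mem' := by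
    rintro a b ⟨k, hk⟩ ⟨l, hl⟩
    refine ⟨k + l, fun x => (abs_add_le (a.1 x) (b.1 x)).trans ?_⟩
    push_cast
    rw [add_mul]
    exact add_le_add (hk x) (hl x)
  neg_mem' := by
    rintro a ⟨k, hk⟩
    exact ⟨k, fun x => (abs_neg (a.1 x)).trans_le (hk x)⟩

theorem FA.isLIdeal_principalIdeal {n : ℕ} (g : FA n) (hg : ∀ x, 0 ≤ g.1 x) :
    (FA.principalIdeal g).IsLIdeal := by
  have hmono : ∀ {k l : ℕ}, k ≤ l → ∀ x, (k : ℤ) * g.1 x ≤ l * g.1 x := fun h x =>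
    mul_le_mul_of_nonneg_right (by exact_mod_cast h) (hg x)
  refine ⟨⟨?_⟩, ?_⟩
  · rintro a ⟨k, hk⟩ b ⟨l, hl⟩ c ⟨hac, hcb⟩
    refine ⟨max k l, fun x => (abs_le_max_abs_abs (hac x) (hcb x)).trans (max_le ?_ ?_)⟩
    · exact (hk x).trans (hmono (le_max_left _ _) x)
    · exact (hl x).trans (hmono (le_max_right _ _) x)
  · rintro a ⟨k, hk⟩ b ⟨l, hl⟩
    refine ⟨⟨max k l, fun x => ?_⟩, ⟨max k l, fun x => ?_⟩⟩
    · refine (abs_max_le_max_abs_abs).trans (max_le ?_ ?_)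
      · exact (hk x).trans (hmono (le_max_left _ _) x)
      · exact (hl x).trans (hmono (le_max_right _ _) x)
    · refine (abs_min_le_max_abs_abs).trans (max_le ?_ ?_)
      · exact (hk x).trans (hmono (le_max_left _ _) x)
      · exact (hl x).trans (hmono (le_max_right _ _) x)

/-- A finitely generated `ℓ`-ideal of `FA n` consists of the elements that are bounded by a multiple
of some fixed nonnegative element. -/
theorem FA.exists_mem_iff_of_isFGLIdeal {n : ℕ} {I : AddSubgroup (FA n)} (hI : I.IsFGLIdeal) :
    ∃ g : FA n, (∀ x, 0 ≤ g.1 x) ∧ ∀ f : FA n, f ∈ I ↔ ∃ k : ℕ, ∀ x, |f.1 x| ≤ k * g.1 x := by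
  obtain ⟨S, ⟨hIL, hSI⟩, hleast⟩ := hI
  let g : FA n := ∑ s ∈ S, (s ⊔ -s)
  have hgx : ∀ x, g.1 x = ∑ s ∈ S, |s.1 x| := fun x => by
    simp only [g, AddSubgroup.val_finsetSum, Finset.sum_apply]
    rfl
  have hg : ∀ x, 0 ≤ g.1 x := fun x => by
    rw [hgx]
    exact Finset.sum_nonneg fun s _ => abs_nonneg _
  have hgI : g ∈ I := I.sum_mem fun s hs => (hIL.2 s (hSI hs) (-s) (I.neg_mem (hSI hs))).1
  refine ⟨g, hg, fun f => ⟨fun hf => ?_, ?_⟩⟩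
  · refine hleast (a := FA.principalIdeal g)
      ⟨FA.isLIdeal_principalIdeal g hg, fun s hs => ⟨1, fun x => ?_⟩⟩ hf
    rw [hgx, Nat.cast_one, one_mul]
    exact Finset.single_le_sum (f := fun s : FA n => |s.1 x|) (fun s _ => abs_nonneg _) hs
  · rintro ⟨k, hk⟩
    have hkg : k • g ∈ I := I.nsmul_mem hgI k
    have hkx : ∀ x, (k • g).1 x = k * g.1 x := fun x => by simp
    refine hIL.1.out (I.neg_mem hkg) hkg ⟨FA.le_iff.2 fun x => ?_, FA.le_iff.2 fun x => ?_⟩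
    · change -((k • g).1 x) ≤ _
      rw [hkx]
      exact (abs_le.1 (hk x)).1
    · rw [hkx]
      exact (abs_le.1 (hk x)).2

/-! ### Reduction to linear inequalities and conclusion -/

/-- In a finitely presented abelian lattice-ordered group, finitely many homogeneous linear
inequalities in the coefficients decide whether a combination of given elements is nonnegative. -/
theorem IsFinitelyPresentedLGroup.exists_finite_inequalities {G : Type*} [AddCommGroup G]
    [Lattice G] (hG : IsFinitelyPresentedLGroup G) {m : ℕ} (u : Fin m → G) :
    ∃ H : Set ((Fin m → ℤ) →+ ℤ), H.Finite ∧
      ∀ X : Fin m → ℤ, 0 ≤ ∑ j, X j • u j ↔ ∀ h ∈ H, 0 ≤ h X := by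
  obtain ⟨n, I, -, hI, e, -, hinf⟩ := hG
  obtain ⟨g, hg, hmem⟩ := FA.exists_mem_iff_of_isFGLIdeal hI
  have hfg : AddMonoid.FG (Fin n → ℤ) := AddGroup.fg_iff_addMonoid_fg.1 inferInstance
  have hlift : ∀ j, ∃ f : FA n, e (f : FA n ⧸ I) = u j := fun j => by
    obtain ⟨f, hf⟩ := QuotientAddGroup.mk_surjective (e.symm (u j))
    exact ⟨f, by rw [hf, e.apply_symm_apply]⟩
  choose f hf using hlift
  have hnonneg : ∀ a : FA n, 0 ≤ e (a : FA n ⧸ I) ↔ ∃ k : ℕ, ∀ x, -a.1 x ≤ k * g.1 x := by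
    intro a
    have h0 : e ((0 : FA n) : FA n ⧸ I) = 0 := by simp
    -- The order of `G` is read off from meets: `0 ≤ e a` means that `a ⊓ 0`, the negative part of
    -- `a` up to sign, lies in `I`.
    rw [← inf_eq_right, ← h0, ← hinf, e.injective.eq_iff, QuotientAddGroup.mk_zero,
      QuotientAddGroup.eq_zero_iff, hmem]
    refine exists_congr fun k => forall_congr' fun x => ?_
    have hkg : 0 ≤ (k : ℤ) * g.1 x := mul_nonneg (Int.natCast_nonneg k) (hg x)
    have hax : (a ⊓ 0).1 x = min (a.1 x) 0 := rfl
    rw [hax, abs_of_nonpos (min_le_right _ _)]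
    omega
  have hPA : PiecewiseAdditive (insert g.1 (Set.range fun j => (f j).1)) := by
    refine PiecewiseAdditive.of_finite ((Set.finite_range _).insert _) ?_
    rintro _ (rfl | ⟨j, rfl⟩)
    · exact FA.piecewiseAdditive g
    · exact FA.piecewiseAdditive (f j)
  obtain ⟨T, hT, htest⟩ := hPA.exists_finite_test hg
  let φ : (Fin n → ℤ) → (Fin m → ℤ) →+ ℤ := fun t =>
    ∑ j, (AddMonoidHom.mulRight ((f j).1 t)).comp (Pi.evalAddMonoidHom (fun _ => ℤ) j)
  refine ⟨φ '' T, hT.image φ, fun X => ?_⟩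
  have hsum : ∑ j, X j • u j = e ((∑ j, X j • f j : FA n) : FA n ⧸ I) := by
    have h := map_sum (e.toAddMonoidHom.comp (QuotientAddGroup.mk' I)) (fun j => X j • f j)
      Finset.univ
    simp only [map_zsmul] at h
    simp only [← hf]
    exact h.symm
  have hval : ∀ x, (∑ j, X j • f j : FA n).1 x = ∑ j, X j * (f j).1 x := fun x => by
    simp [Finset.sum_apply]
  rw [hsum, hnonneg, htest, Set.forall_mem_image]
  · refine forall₂_congr fun t _ => ?_
    rw [hval]
    simp [φ]
  · intro C hC x hx y hy
    simp only [hval, ← Finset.sum_add_distrib, ← mul_add]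
    exact Finset.sum_congr rfl fun j _ => congrArg (X j * ·) (hC _ ⟨j, rfl⟩ x hx y hy)

/-- Every finitely presented abelian lattice-ordered group, viewed as a partially ordered
`ℤ`-module, is po-coherent. -/
theorem theoremD (G : Type*) [AddCommGroup G] [Lattice G] [IsOrderedAddMonoid G]
    (hG : IsFinitelyPresentedLGroup G) : PoCoherent ℤ G := by
  refine fun B hB => ⟨Module.Finite.iff_fg.2 hB, fun m U _ _ => ?_⟩
  obtain ⟨H, hH, hmem⟩ := hG.exists_finite_inequalities fun j => (U j : G)
  obtain ⟨Q, hQ, hQmem⟩ := (AddSubmonoid.fg_nonneg_pi m).sep_nonneg hH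
  refine PointedCone.fg_of_toAddSubmonoid_fg ?_
  refine (SetLike.ext fun X => ?_ : (mixedSolutions ℤ U).toAddSubmonoid = Q) ▸ hQ
  rw [hQmem, ← hmem, and_comm]
  have hcoe : ((∑ j, X j • U j : B) : G) = ∑ j, X j • (U j : G) := by simp
  rw [← hcoe]
  exact Iff.rfl
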